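/- Call a complex random variable $Y$ rigidly sub-Gaussian if $Y$ and $e^{i\theta}Y$ have the same law for every $\theta\in\mathbb R$ and $\mathbb E|Y|^{2k}\le k!\,(\mathbb E|Y|^2)^k<\infty$ for every $k\in\mathbb N$. For $T\in(\mathbb C^d)^{\otimes p}$ let $$\|T\|_{\mathrm{inj}}=\max\Big\{\Big|\sum_{i_1,\dots,i_p=1}^d\overline{T_{i_1,\dots,i_p}}\,(u_1)_{i_1}\cdots(u_p)_{i_p}\Big| : u_1,\dots,u_p\in\mathbb C^d,\ \|u_m\|_2=1\Big\}.$$ Let $p\ge 1$, $R\ge 0$ and $d\ge1$ be integers, and let $x_m^{(i)}$ $(1\le i\le R,\ 1\le m\le p)$ be independent random vectors in $\mathbb C^d$, each with i.i.d. rigidly sub-Gaussian entries $Y$ with $\mathbb E|Y|^2=1/d$ (the law of the entries may depend on $i$, $m$ and $d$). Put $T=\sum_{i=1}^R x_1^{(i)}\otimes\cdots\otimes x_p^{(i)}$. Then $\|T\|_{\mathrm{inj}}$ is integrable and for all integers $d,k\ge 1$ $$\mathbb E\|T\|_{\mathrm{inj}}\le\frac1{d^{p/2}}\Big(\binom{d+k-1}{k}^{p}(k!)^2\sum_{\mathbf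 a\in\mathbb N^R,\ \sum_s \mathbf a_s=k}\ \prod_{s=1}^R(\mathbf a_s!)^{p-2}\Big)^{\frac1{2k}}.$$ Moreover, if $p\ge 2$ and $R\ge 1$ are fixed, then $\lim_{d\to\infty}\mathbb E\|T\|_{\mathrm{inj}}=1$. -/

import Mathlib

open MeasureTheory ProbabilityTheory Filter Topology

noncomputable section

/-- The injective norm of a complex tensor of order `p` on `ℂ^d`, given by its coordinates
`T i = T_{i_1,…,i_p}`: the maximum of `|⟨T, u_1 ⊗ ⋯ ⊗ u_p⟩|` over unit vectors `u_m` of `ℂ^d`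
for the Euclidean norm (for `1 ≤ d` the set below is nonempty and compact, so that the supremum
is attained). -/
def injNorm {p d : ℕ} (T : (Fin p → Fin d) → ℂ) : ℝ :=
  sSup {r : ℝ | ∃ u : Fin p → EuclideanSpace ℂ (Fin d), (∀ m, ‖u m‖ = 1) ∧
    r = ‖∑ i : Fin p → Fin d, (starRingEnd ℂ) (T i) * ∏ m, u m (i m)‖}

/-- A complex random variable is rigidly sub-Gaussian if it is circularly symmetric and
`E|Y|^{2k} ≤ k! (E|Y|²)^k` for all `k`; these moments are required to be finite. -/
structure IsRigidlySubGaussian {Ω : Type*} [MeasurableSpace Ω] (P : Measure Ω) (Y : Ω → ℂ) :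
    Prop where
  measurable : Measurable Y
  circular : ∀ θ : ℝ, P.map (fun ω => Complex.exp (θ * Complex.I) * Y ω) = P.map Y
  integrable : ∀ k : ℕ, Integrable (fun ω => ‖Y ω‖ ^ (2 * k)) P
  moment_le : ∀ k : ℕ,
    ∫ ω, ‖Y ω‖ ^ (2 * k) ∂P ≤ (k.factorial : ℝ) * (∫ ω, ‖Y ω‖ ^ 2 ∂P) ^ k

/-- The data of the bounded-rank model: `x i m` is the random vector `x_m^{(i)}` of `ℂ^d`, with
coordinates `x i m j`. The `R * p` vectors are independent, and each has i.i.d. rigidly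
sub-Gaussian entries of variance `1 / d`; since the entries of each vector are independent too,
this is joint independence of all coordinates. The law of the entries may differ from one vector
to another. -/
structure IsBoundedRankModel {Ω : Type*} [MeasurableSpace Ω] (P : Measure Ω) {R p d : ℕ}
    (x : Fin R → Fin p → Fin d → Ω → ℂ) : Prop where
  rigid : ∀ i m j, IsRigidlySubGaussian P (x i m j)
  variance : ∀ i m j, ∫ ω, ‖x i m j ω‖ ^ 2 ∂P = 1 / (d : ℝ)
  ident : ∀ i m j j', P.map (x i m j) = P.map (x i m j')
  indep : iIndepFun (fun q : Fin R × Fin p × Fin d => x q.1 q.2.1 q.2.2) P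

/-- The random tensor `T = ∑_{i ≤ R} x_1^{(i)} ⊗ ⋯ ⊗ x_p^{(i)}` in coordinates. -/
def boundedRankTensor {Ω : Type*} {R p d : ℕ} (x : Fin R → Fin p → Fin d → Ω → ℂ) (ω : Ω) :
    (Fin p → Fin d) → ℂ :=
  fun j => ∑ i, ∏ m, x i m (j m) ω

end

/-- All mixed moments `E[f^a conj(f)^b]` exist, and vanish for `a ≠ b`. -/
structure HasCircularMoments {α : Type*} [MeasurableSpace α] (μ : Measure α) (f : α → ℂ) :
    Prop where
  integrable : ∀ a b : ℕ, Integrable (fun z => f z ^ a * (starRingEnd ℂ) (f z) ^ b) μ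
  orthogonal : ∀ a b : ℕ, a ≠ b → ∫ z, f z ^ a * (starRingEnd ℂ) (f z) ^ b ∂μ = 0

lemma pow_mul_conj_pow (z : ℂ) (k : ℕ) :
    z ^ k * (starRingEnd ℂ) z ^ k = ((‖z‖ ^ (2 * k) : ℝ) : ℂ) := by
  rw [← mul_pow, Complex.mul_conj, Complex.normSq_eq_norm_sq, pow_mul]
  push_cast
  rfl

namespace HasCircularMoments

variable {α : Type*} [MeasurableSpace α] {μ : Measure α} {f : α → ℂ}

lemma aestronglyMeasurable (h : HasCircularMoments μ f) : AEStronglyMeasurable f μ := by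
  simpa using (h.integrable 1 0).aestronglyMeasurable

lemma integral_eq (h : HasCircularMoments μ f) (a b : ℕ) :
    ∫ z, f z ^ a * (starRingEnd ℂ) (f z) ^ b ∂μ =
      if a = b then ((∫ z, ‖f z‖ ^ (2 * a) ∂μ : ℝ) : ℂ) else 0 := by
  split_ifs with hab
  · subst hab
    simp_rw [pow_mul_conj_pow]
    exact integral_ofReal
  · exact h.orthogonal a b hab

lemma integrable_norm_pow (h : HasCircularMoments μ f) (k : ℕ) :
    Integrable (fun z => ‖f z‖ ^ (2 * k)) μ := by
  have := (h.integrable k k).norm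
  refine this.congr (Eventually.of_forall fun z => ?_)
  simp [pow_mul', sq]

lemma const_mul (h : HasCircularMoments μ f) (c : ℂ) :
    HasCircularMoments μ (fun z => c * f z) := by
  have key : ∀ a b : ℕ, (fun z => (c * f z) ^ a * (starRingEnd ℂ) (c * f z) ^ b) =
      fun z => (c ^ a * (starRingEnd ℂ) c ^ b) * (f z ^ a * (starRingEnd ℂ) (f z) ^ b) := by
    intro a b
    ext z
    simp only [map_mul, mul_pow]
    ring
  constructor
  · intro a b
    rw [key]
    exact (h.integrable a b).const_mul _
  · intro a b hab
    rw [key, integral_const_mul, h.orthogonal a b hab, mul_zero]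

lemma conj (h : HasCircularMoments μ f) :
    HasCircularMoments μ (fun z => (starRingEnd ℂ) (f z)) := by
  constructor
  · intro a b
    simpa [mul_comm] using h.integrable b a
  · intro a b hab
    simpa [mul_comm] using h.orthogonal b a hab.symm

end HasCircularMoments

section Product

variable {ι : Type*} [Fintype ι] {α : ι → Type*} [∀ i, MeasurableSpace (α i)]
  {μ : ∀ i, Measure (α i)} [∀ i, SigmaFinite (μ i)] {f : ∀ i, α i → ℂ}

/-- A nonempty product of independent variables with circular moments. -/
lemma HasCircularMoments.prod [Nonempty ι] (h : ∀ i, HasCircularMoments (μ i) (f i)) :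
    HasCircularMoments (Measure.pi μ) (fun y => ∏ i, f i (y i)) := by
  have key : ∀ a b : ℕ, (fun y : ∀ i, α i => (∏ i, f i (y i)) ^ a *
      (starRingEnd ℂ) (∏ i, f i (y i)) ^ b) =
      fun y => ∏ i, (f i (y i) ^ a * (starRingEnd ℂ) (f i (y i)) ^ b) := by
    intro a b
    ext y
    simp [Finset.prod_mul_distrib, Finset.prod_pow]
  constructor
  · intro a b
    rw [key]
    exact Integrable.fintype_prod_dep (fun i => (h i).integrable a b)
  · intro a b hab
    rw [key, integral_fintype_prod_eq_prod
      (fun i z => f i z ^ a * (starRingEnd ℂ) (f i z) ^ b)]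
    obtain ⟨i⟩ := ‹Nonempty ι›
    exact Finset.prod_eq_zero (Finset.mem_univ i) ((h i).orthogonal a b hab)

lemma integral_prod_pow_mul_conj_pow (h : ∀ i, HasCircularMoments (μ i) (f i)) (r s : ι → ℕ) :
    ∫ y, ∏ i, (f i (y i) ^ r i * (starRingEnd ℂ) (f i (y i)) ^ s i) ∂(Measure.pi μ) =
      if r = s then ((∏ i, ∫ z, ‖f i z‖ ^ (2 * r i) ∂(μ i) : ℝ) : ℂ) else 0 := by
  rw [integral_fintype_prod_eq_prod
      (fun i z => f i z ^ r i * (starRingEnd ℂ) (f i z) ^ s i)]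
  simp_rw [fun i => (h i).integral_eq]
  split_ifs with hrs
  · subst hrs
    simp
  · obtain ⟨i, hi⟩ := Function.ne_iff.1 hrs
    exact Finset.prod_eq_zero (Finset.mem_univ i) (if_neg hi)

lemma integrable_sum_pow_term (h : ∀ i, HasCircularMoments (μ i) (f i)) (c : ℂ) (r s : ι → ℕ) :
    Integrable (fun y => c * ∏ i, (f i (y i) ^ r i * (starRingEnd ℂ) (f i (y i)) ^ s i))
      (Measure.pi μ) :=
  (Integrable.fintype_prod_dep (f := fun i z => f i z ^ r i * (starRingEnd ℂ) (f i z) ^ s i)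
    (fun i => (h i).integrable (r i) (s i))).const_mul c

/-- Even absolute moments of a product of independent variables. -/
lemma integral_norm_prod_pow (k : ℕ) :
    ∫ y, ‖∏ i, f i (y i)‖ ^ (2 * k) ∂(Measure.pi μ) =
      ∏ i, ∫ z, ‖f i z‖ ^ (2 * k) ∂(μ i) := by
  simp_rw [norm_prod, ← Finset.prod_pow]
  exact integral_fintype_prod_eq_prod (fun i z => ‖f i z‖ ^ (2 * k))

variable [DecidableEq ι]

lemma sum_pow_mul_conj_sum_pow (w : ι → ℂ) (a b : ℕ) :
    (∑ i, w i) ^ a * (starRingEnd ℂ) (∑ i, w i) ^ b =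
      ∑ r ∈ Finset.piAntidiag (Finset.univ : Finset ι) a,
        ∑ s ∈ Finset.piAntidiag (Finset.univ : Finset ι) b,
          ((Nat.multinomial Finset.univ r : ℂ) * (Nat.multinomial Finset.univ s : ℂ)) *
            ∏ i, (w i ^ r i * (starRingEnd ℂ) (w i) ^ s i) := by
  rw [map_sum, Finset.sum_pow_eq_sum_piAntidiag, Finset.sum_pow_eq_sum_piAntidiag,
    Finset.sum_mul_sum]
  refine Finset.sum_congr rfl fun r _ => Finset.sum_congr rfl fun s _ => ?_
  rw [Finset.prod_mul_distrib]
  ring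

lemma integral_sum_pow_mul_conj (h : ∀ i, HasCircularMoments (μ i) (f i)) (a b : ℕ) :
    ∫ y, (∑ i, f i (y i)) ^ a * (starRingEnd ℂ) (∑ i, f i (y i)) ^ b ∂(Measure.pi μ) =
      ∑ r ∈ Finset.piAntidiag (Finset.univ : Finset ι) a,
        ∑ s ∈ Finset.piAntidiag (Finset.univ : Finset ι) b,
          ((Nat.multinomial Finset.univ r : ℂ) * (Nat.multinomial Finset.univ s : ℂ)) *
            if r = s then ((∏ i, ∫ z, ‖f i z‖ ^ (2 * r i) ∂(μ i) : ℝ) : ℂ) else 0 := by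
  simp_rw [sum_pow_mul_conj_sum_pow]
  rw [integral_finsetSum _ fun r _ => integrable_finsetSum _ fun s _ =>
    integrable_sum_pow_term h _ r s]
  refine Finset.sum_congr rfl fun r _ => ?_
  rw [integral_finsetSum _ fun s _ => integrable_sum_pow_term h _ r s]
  refine Finset.sum_congr rfl fun s _ => ?_
  rw [integral_const_mul, integral_prod_pow_mul_conj_pow h]

/-- A sum of independent variables with circular moments. -/
lemma HasCircularMoments.sum (h : ∀ i, HasCircularMoments (μ i) (f i)) :
    HasCircularMoments (Measure.pi μ) (fun y => ∑ i, f i (y i)) := by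
  constructor
  · intro a b
    simp_rw [sum_pow_mul_conj_sum_pow]
    exact integrable_finsetSum _ fun r _ => integrable_finsetSum _ fun s _ =>
      integrable_sum_pow_term h _ r s
  · intro a b hab
    rw [integral_sum_pow_mul_conj h]
    refine Finset.sum_eq_zero fun r hr => Finset.sum_eq_zero fun s hs => ?_
    rw [if_neg, mul_zero]
    rintro rfl
    rw [Finset.mem_piAntidiag] at hr hs
    exact hab (hr.1.symm.trans hs.1)

/-- Even absolute moments of a sum of independent variables with circular moments. -/
lemma HasCircularMoments.integral_norm_sum_pow (h : ∀ i, HasCircularMoments (μ i) (f i)) (k : ℕ) :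
    ∫ y, ‖∑ i, f i (y i)‖ ^ (2 * k) ∂(Measure.pi μ) =
      ∑ r ∈ Finset.piAntidiag (Finset.univ : Finset ι) k,
        (Nat.multinomial Finset.univ r : ℝ) ^ 2 * ∏ i, ∫ z, ‖f i z‖ ^ (2 * r i) ∂(μ i) := by
  have h1 := integral_sum_pow_mul_conj h k k
  simp_rw [pow_mul_conj_pow, integral_complex_ofReal] at h1
  apply Complex.ofReal_injective
  rw [h1]
  push_cast
  refine Finset.sum_congr rfl fun r hr => ?_
  rw [Finset.sum_eq_single_of_mem r hr]
  · simp [sq]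
  · intro s _ hs
    rw [if_neg hs.symm, mul_zero]

lemma multinomial_mul_prod_factorial (r : ι → ℕ) {k : ℕ}
    (hr : r ∈ Finset.piAntidiag (Finset.univ : Finset ι) k) :
    (Nat.multinomial Finset.univ r : ℝ) * ∏ i, ((r i).factorial : ℝ) = k.factorial := by
  rw [Finset.mem_piAntidiag] at hr
  have := Nat.multinomial_spec Finset.univ r
  rw [hr.1] at this
  rw [mul_comm]
  exact_mod_cast this

lemma sum_multinomial_sq_mul_factorial (v : ι → ℝ) (k : ℕ) :
    ∑ r ∈ Finset.piAntidiag (Finset.univ : Finset ι) k,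
      (Nat.multinomial Finset.univ r : ℝ) ^ 2 * ∏ i, ((r i).factorial * v i ^ r i) =
      k.factorial * (∑ i, v i) ^ k := by
  rw [Finset.sum_pow_eq_sum_piAntidiag, Finset.mul_sum]
  refine Finset.sum_congr rfl fun r hr => ?_
  rw [Finset.prod_mul_distrib, ← multinomial_mul_prod_factorial r hr]
  ring

/-- Sub-Gaussian moment bounds pass to independent sums. -/
lemma HasCircularMoments.integral_norm_sum_pow_le (h : ∀ i, HasCircularMoments (μ i) (f i))
    {v : ι → ℝ} (hv : ∀ i (k : ℕ), ∫ z, ‖f i z‖ ^ (2 * k) ∂(μ i) ≤ k.factorial * v i ^ k) (k : ℕ) :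
    ∫ y, ‖∑ i, f i (y i)‖ ^ (2 * k) ∂(Measure.pi μ) ≤ k.factorial * (∑ i, v i) ^ k := by
  rw [HasCircularMoments.integral_norm_sum_pow h, ← sum_multinomial_sq_mul_factorial]
  gcongr with r hr i _
  exact hv i (r i)

lemma HasCircularMoments.integral_norm_sum_pow_eq (h : ∀ i, HasCircularMoments (μ i) (f i))
    {v : ι → ℝ} (hv : ∀ i (k : ℕ), ∫ z, ‖f i z‖ ^ (2 * k) ∂(μ i) = k.factorial * v i ^ k) (k : ℕ) :
    ∫ y, ‖∑ i, f i (y i)‖ ^ (2 * k) ∂(Measure.pi μ) = k.factorial * (∑ i, v i) ^ k := by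
  rw [HasCircularMoments.integral_norm_sum_pow h, ← sum_multinomial_sq_mul_factorial]
  simp_rw [hv]

/-- Moments of the squared Euclidean norm of a vector with independent coordinates. -/
lemma HasCircularMoments.integral_sum_norm_sq_pow (h : ∀ i, HasCircularMoments (μ i) (f i))
    (k : ℕ) :
    Integrable (fun y => (∑ i, ‖f i (y i)‖ ^ 2) ^ k) (Measure.pi μ) ∧
    ∫ y, (∑ i, ‖f i (y i)‖ ^ 2) ^ k ∂(Measure.pi μ) =
      ∑ r ∈ Finset.piAntidiag (Finset.univ : Finset ι) k,
        (Nat.multinomial Finset.univ r : ℝ) * ∏ i, ∫ z, ‖f i z‖ ^ (2 * r i) ∂(μ i) := by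
  have hint : ∀ r : ι → ℕ, Integrable (fun y : ∀ i, α i => (Nat.multinomial Finset.univ r : ℝ) *
      ∏ i, ‖f i (y i)‖ ^ (2 * r i)) (Measure.pi μ) := fun r =>
    (Integrable.fintype_prod_dep (f := fun i z => ‖f i z‖ ^ (2 * r i)) fun i =>
      (h i).integrable_norm_pow (r i)).const_mul _
  simp_rw [Finset.sum_pow_eq_sum_piAntidiag, ← pow_mul]
  refine ⟨integrable_finsetSum _ fun r _ => hint r, ?_⟩
  rw [integral_finsetSum _ fun r _ => hint r]
  refine Finset.sum_congr rfl fun r _ => ?_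
  rw [integral_const_mul, integral_fintype_prod_eq_prod (fun i z => ‖f i z‖ ^ (2 * r i))]

lemma card_piAntidiag_univ (k : ℕ) :
    (Finset.piAntidiag (Finset.univ : Finset ι) k).card =
      (Fintype.card ι + k - 1).choose k := by
  have := Finset.map_sym_eq_piAntidiag (Finset.univ : Finset ι) k
  rw [← this, Finset.card_map, Finset.sym_univ, Finset.card_univ, Sym.card_sym_eq_choose]

lemma sum_multinomial_mul_factorial (v : ℝ) (k : ℕ) :
    ∑ r ∈ Finset.piAntidiag (Finset.univ : Finset ι) k,
      (Nat.multinomial Finset.univ r : ℝ) * ∏ i, ((r i).factorial * v ^ r i) =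
      k.factorial * (Fintype.card ι + k - 1).choose k * v ^ k := by
  rw [← card_piAntidiag_univ, mul_comm (k.factorial : ℝ), mul_assoc, ← nsmul_eq_mul]
  refine Finset.sum_eq_card_nsmul fun r hr => ?_
  rw [Finset.prod_mul_distrib, ← mul_assoc, multinomial_mul_prod_factorial r hr,
    Finset.prod_pow_eq_pow_sum, (Finset.mem_piAntidiag.1 hr).1]

end Product

lemma hasCircularMoments_of_map_eq {α : Type*} [MeasurableSpace α] {μ : Measure α} {f : α → ℂ}
    (hf : Measurable f) (hint : ∀ k : ℕ, Integrable (fun z => ‖f z‖ ^ (2 * k)) μ)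
    (hcirc : ∀ θ : ℝ, μ.map (fun z => Complex.exp (θ * Complex.I) * f z) = μ.map f) :
    HasCircularMoments μ f := by
  constructor
  · intro a b
    refine Integrable.mono' ((hint a).add (hint b))
      (by fun_prop) (Eventually.of_forall fun z => ?_)
    simp only [norm_mul, norm_pow, RCLike.norm_conj, Pi.add_apply, pow_mul']
    nlinarith [sq_nonneg (‖f z‖ ^ a - ‖f z‖ ^ b), sq_nonneg (‖f z‖ ^ a), sq_nonneg (‖f z‖ ^ b)]
  · intro a b hab
    have hmeas : Measurable (fun w : ℂ => w ^ a * (starRingEnd ℂ) w ^ b) := by fun_prop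
    have key : ∀ θ : ℝ, Complex.exp (θ * Complex.I) ^ a * Complex.exp (-(θ * Complex.I)) ^ b *
        ∫ z, f z ^ a * (starRingEnd ℂ) (f z) ^ b ∂μ =
        ∫ z, f z ^ a * (starRingEnd ℂ) (f z) ^ b ∂μ := by
      intro θ
      have h1 := integral_map (μ := μ) hf.aemeasurable hmeas.aestronglyMeasurable
      have h2 := integral_map (μ := μ)
        (φ := fun z => Complex.exp (θ * Complex.I) * f z) (by fun_prop)
        hmeas.aestronglyMeasurable
      rw [hcirc θ, h1] at h2
      rw [← integral_const_mul]
      refine Eq.trans ?_ h2.symm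
      congr 1
      ext z
      rw [map_mul, ← Complex.exp_conj]
      simp only [map_mul, Complex.conj_ofReal, Complex.conj_I, mul_pow, mul_neg]
      ring
    have hab' : ((a : ℝ) - b) ≠ 0 := sub_ne_zero.2 (by exact_mod_cast hab)
    have h := key (Real.pi / (a - b))
    rw [← Complex.exp_nat_mul, ← Complex.exp_nat_mul, ← Complex.exp_add] at h
    have hπ : (a : ℂ) * (((Real.pi / (a - b) : ℝ) : ℂ) * Complex.I) +
        b * -(((Real.pi / (a - b) : ℝ) : ℂ) * Complex.I) = Real.pi * Complex.I := by
      have : (a : ℂ) - b ≠ 0 := by exact_mod_cast hab'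
      push_cast
      field_simp
      ring
    rw [hπ, Complex.exp_pi_mul_I] at h
    have : (2 : ℂ) * ∫ z, f z ^ a * (starRingEnd ℂ) (f z) ^ b ∂μ = 0 := by
      linear_combination -h
    simpa using this

/-- The standard complex Gaussian measure, with density `exp (-|z|²) / π`. -/
noncomputable def complexGaussian : Measure ℂ :=
  volume.withDensity (fun z => ENNReal.ofReal (Real.exp (-‖z‖ ^ 2) / Real.pi))

lemma integral_norm_pow_mul_exp (k : ℕ) :
    ∫ z : ℂ, ‖z‖ ^ (2 * k) * (Real.exp (-‖z‖ ^ 2) / Real.pi) = k.factorial := by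
  have h := Complex.integral_rpow_mul_exp_neg_rpow (p := 2) (q := (2 * k : ℕ)) (by norm_num)
    (by have : (0 : ℝ) ≤ ((2 * k : ℕ) : ℝ) := by positivity
        linarith)
  simp_rw [Real.rpow_natCast, Real.rpow_two] at h
  simp_rw [← mul_div_assoc]
  rw [integral_div, h]
  have : (((2 * k : ℕ) : ℝ) + 2) / 2 = k + 1 := by push_cast; ring
  rw [this, Real.Gamma_nat_eq_factorial]
  field_simp

lemma integral_norm_pow_complexGaussian (k : ℕ) :
    ∫ z, ‖z‖ ^ (2 * k) ∂complexGaussian = k.factorial := by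
  rw [complexGaussian, integral_withDensity_eq_integral_toReal_smul (by fun_prop)
    (Eventually.of_forall fun _ => ENNReal.ofReal_lt_top), ← integral_norm_pow_mul_exp k]
  congr 1
  ext z
  rw [ENNReal.toReal_ofReal (by positivity), smul_eq_mul, mul_comm]

instance : IsProbabilityMeasure complexGaussian := by
  constructor
  have h := integral_norm_pow_mul_exp 0
  simp only [mul_zero, pow_zero, one_mul, Nat.factorial_zero, Nat.cast_one] at h
  rw [complexGaussian, withDensity_apply _ MeasurableSet.univ, Measure.restrict_univ,
    ← ofReal_integral_eq_lintegral_ofReal _ (Eventually.of_forall fun z => by positivity), h,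
    ENNReal.ofReal_one]
  exact Integrable.of_integral_ne_zero (by rw [h]; exact one_ne_zero)

lemma complexGaussian_map_mul (θ : ℝ) :
    complexGaussian.map (fun z => Complex.exp (θ * Complex.I) * z) = complexGaussian := by
  have hmp : MeasurePreserving (fun z : ℂ => Complex.exp (θ * Complex.I) * z) volume volume := by
    have hrot : (fun z : ℂ => Complex.exp (θ * Complex.I) * z) = rotation (Circle.exp θ) := by
      ext z
      simp [rotation_apply]
    rw [hrot]
    exact (rotation (Circle.exp θ)).measurePreserving
  ext s hs
  rw [Measure.map_apply (by fun_prop) hs, complexGaussian,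
    withDensity_apply _ (hs.preimage (by fun_prop)), withDensity_apply _ hs,
    ← hmp.setLIntegral_comp_preimage hs (by fun_prop)]
  simp [Complex.norm_exp_ofReal_mul_I]

lemma hasCircularMoments_complexGaussian : HasCircularMoments complexGaussian (fun z => z) := by
  refine hasCircularMoments_of_map_eq measurable_id (fun k => ?_) fun θ => ?_
  · refine Integrable.of_integral_ne_zero ?_
    rw [integral_norm_pow_complexGaussian]
    positivity
  · rw [complexGaussian_map_mul θ]
    exact Measure.map_id.symm

lemma norm_sum_mul_sq_le {ι : Type*} [Fintype ι] (a b : ι → ℂ) :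
    ‖∑ j, a j * b j‖ ^ 2 ≤ (∑ j, ‖a j‖ ^ 2) * ∑ j, ‖b j‖ ^ 2 := by
  calc ‖∑ j, a j * b j‖ ^ 2 ≤ (∑ j, ‖a j‖ * ‖b j‖) ^ 2 := by
        gcongr
        exact (norm_sum_le _ _).trans_eq (by simp)
    _ ≤ _ := Finset.sum_mul_sq_le_sq_mul_sq _ _ _

section Vector

variable {ι : Type*} [Fintype ι] [DecidableEq ι]

lemma integral_sum_norm_sq_pow_complexGaussian (k : ℕ) :
    ∫ g : ι → ℂ, (∑ j, ‖g j‖ ^ 2) ^ k ∂(Measure.pi fun _ => complexGaussian) =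
      k.factorial * (Fintype.card ι + k - 1).choose k := by
  have h := sum_multinomial_mul_factorial (ι := ι) 1 k
  simp only [one_pow, mul_one] at h
  rw [(HasCircularMoments.integral_sum_norm_sq_pow
    (fun _ : ι => hasCircularMoments_complexGaussian) k).2, ← h]
  simp_rw [integral_norm_pow_complexGaussian]

/-- The value of a linear form on a unit vector is controlled by its Gaussian moments. -/
lemma factorial_mul_norm_pow_le_lintegral (φ : (ι → ℂ) →ₗ[ℂ] ℂ) {u : ι → ℂ}
    (hu : ∑ j, ‖u j‖ ^ 2 = 1) (k : ℕ) :
    ENNReal.ofReal (k.factorial * ‖φ u‖ ^ (2 * k)) ≤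
      ∫⁻ g, ENNReal.ofReal (‖φ g‖ ^ (2 * k)) ∂(Measure.pi fun _ => complexGaussian) := by
  set c : ι → ℂ := fun j => φ fun i => if j = i then 1 else 0 with hc
  have hφ : ∀ g, φ g = ∑ j, c j * g j := fun g => by
    rw [φ.pi_apply_eq_sum_univ g]
    simp [hc, mul_comm]
  have hcirc : ∀ j, HasCircularMoments complexGaussian (fun z => c j * z) := fun j =>
    hasCircularMoments_complexGaussian.const_mul (c j)
  simp_rw [hφ]
  rw [← ofReal_integral_eq_lintegral_ofReal
    ((HasCircularMoments.sum hcirc).integrable_norm_pow k)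
    (Eventually.of_forall fun g => by positivity),
    HasCircularMoments.integral_norm_sum_pow_eq hcirc (v := fun j => ‖c j‖ ^ 2)]
  · gcongr
    rw [pow_mul]
    gcongr
    exact (norm_sum_mul_sq_le c u).trans_eq (by rw [hu, mul_one])
  · intro j k
    simp_rw [norm_mul, mul_pow]
    rw [integral_const_mul, integral_norm_pow_complexGaussian, pow_mul, mul_comm]

/-- The value of a multilinear form on unit vectors is controlled by its Gaussian moments. -/
lemma factorial_pow_mul_norm_pow_le_lintegral (k : ℕ) {p : ℕ}
    (F : MultilinearMap ℂ (fun _ : Fin p => ι → ℂ) ℂ) (hF : Continuous F) {u : Fin p → ι → ℂ}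
    (hu : ∀ m, ∑ j, ‖u m j‖ ^ 2 = 1) :
    ENNReal.ofReal ((k.factorial : ℝ) ^ p * ‖F u‖ ^ (2 * k)) ≤
      ∫⁻ g, ENNReal.ofReal (‖F g‖ ^ (2 * k))
        ∂(Measure.pi fun _ => Measure.pi fun _ => complexGaussian) := by
  induction p with
  | zero =>
    have : ∀ g, F g = F u := fun g => by rw [Subsingleton.elim g u]
    simp_rw [this]
    simp
  | succ p ih =>
    set Γ : Measure (ι → ℂ) := Measure.pi fun _ => complexGaussian
    have hmp := (measurePreserving_piFinSuccAbove (fun _ : Fin (p + 1) => Γ) 0).symm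
    have hmeas : Measurable fun g => ENNReal.ofReal (‖F g‖ ^ (2 * k)) :=
      ENNReal.measurable_ofReal.comp (hF.norm.pow _).measurable
    rw [← hmp.lintegral_comp hmeas]
    have hmeas' : Measurable fun y : (ι → ℂ) × (Fin p → ι → ℂ) => ENNReal.ofReal
        (‖F ((MeasurableEquiv.piFinSuccAbove (fun _ : Fin (p + 1) => ι → ℂ) 0).symm y)‖ ^
          (2 * k)) := hmeas.comp hmp.measurable
    rw [lintegral_prod _ hmeas'.aemeasurable]
    have hcons : ∀ (x : ι → ℂ) (y : Fin p → ι → ℂ),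
        (MeasurableEquiv.piFinSuccAbove (fun _ : Fin (p + 1) => ι → ℂ) 0).symm (x, y) =
          Fin.cons x y := fun x y => by
      simp [MeasurableEquiv.piFinSuccAbove_symm_apply, Fin.insertNthEquiv]
    simp_rw [hcons]
    have hlin : ∀ x, F.toLinearMap u 0 x = F (Fin.cons x (Fin.tail u)) := fun x => by
      rw [MultilinearMap.toLinearMap_apply]
      congr 1
      conv_lhs => rw [← Fin.cons_self_tail u, Fin.update_cons_zero]
    have h0 := factorial_mul_norm_pow_le_lintegral (F.toLinearMap u 0) (hu 0) k
    simp_rw [hlin, Fin.cons_self_tail] at h0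
    calc ENNReal.ofReal ((k.factorial : ℝ) ^ (p + 1) * ‖F u‖ ^ (2 * k))
        = ENNReal.ofReal ((k.factorial : ℝ) ^ p) *
            ENNReal.ofReal (k.factorial * ‖F u‖ ^ (2 * k)) := by
          rw [← ENNReal.ofReal_mul (by positivity)]
          ring_nf
      _ ≤ ENNReal.ofReal ((k.factorial : ℝ) ^ p) *
            ∫⁻ x, ENNReal.ofReal (‖F (Fin.cons x (Fin.tail u))‖ ^ (2 * k)) ∂Γ := by gcongr
      _ = ∫⁻ x, ENNReal.ofReal ((k.factorial : ℝ) ^ p *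
            ‖F.curryLeft x (Fin.tail u)‖ ^ (2 * k)) ∂Γ := by
          rw [← lintegral_const_mul' _ _ ENNReal.ofReal_ne_top]
          refine lintegral_congr fun x => ?_
          rw [ENNReal.ofReal_mul (by positivity), MultilinearMap.curryLeft_apply]
      _ ≤ _ := lintegral_mono fun x => ih (F.curryLeft x)
          (hF.comp (continuous_const.finCons continuous_id)) fun m => hu m.succ

end Vector

section InjNorm

variable {p d : ℕ}

/-- The multilinear form `u ↦ ⟨T, u_1 ⊗ ⋯ ⊗ u_p⟩`. -/
noncomputable def tensorForm (T : (Fin p → Fin d) → ℂ) :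
    MultilinearMap ℂ (fun _ : Fin p => Fin d → ℂ) ℂ :=
  ∑ i, (starRingEnd ℂ) (T i) •
    (MultilinearMap.mkPiAlgebra ℂ (Fin p) ℂ).compLinearMap (fun m => LinearMap.proj (i m))

lemma tensorForm_apply (T : (Fin p → Fin d) → ℂ) (u : Fin p → Fin d → ℂ) :
    tensorForm T u = ∑ i, (starRingEnd ℂ) (T i) * ∏ m, u m (i m) := by
  simp [tensorForm]

lemma continuous_tensorForm :
    Continuous fun q : ((Fin p → Fin d) → ℂ) × (Fin p → Fin d → ℂ) => tensorForm q.1 q.2 := by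
  simp_rw [tensorForm_apply]
  fun_prop

lemma isCompact_unitVectors :
    IsCompact {u : Fin p → EuclideanSpace ℂ (Fin d) | ∀ m, ‖u m‖ = 1} := by
  have := isCompact_univ_pi (fun _ : Fin p => isCompact_sphere (0 : EuclideanSpace ℂ (Fin d)) 1)
  convert this using 1
  ext u
  simp [Set.mem_pi]

lemma injNorm_eq_sSup_image (T : (Fin p → Fin d) → ℂ) :
    injNorm T = sSup ((fun u : Fin p → EuclideanSpace ℂ (Fin d) =>
      ‖tensorForm T fun m => (u m).ofLp‖) '' {u | ∀ m, ‖u m‖ = 1}) := by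
  unfold injNorm
  congr 1
  ext r
  simp only [tensorForm_apply, Set.mem_ofPred_eq, Set.mem_image]
  exact exists_congr fun u => and_congr_right fun _ => eq_comm

lemma continuous_norm_tensorForm :
    Continuous fun q : ((Fin p → Fin d) → ℂ) × (Fin p → EuclideanSpace ℂ (Fin d)) =>
      ‖tensorForm q.1 fun m => (q.2 m).ofLp‖ :=
  (continuous_tensorForm.comp (continuous_fst.prodMk (by fun_prop))).norm

lemma continuous_injNorm : Continuous (injNorm : ((Fin p → Fin d) → ℂ) → ℝ) := by
  rw [funext injNorm_eq_sSup_image]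
  exact isCompact_unitVectors.continuous_sSup continuous_norm_tensorForm

lemma injNorm_nonneg (T : (Fin p → Fin d) → ℂ) : 0 ≤ injNorm T := by
  rw [injNorm_eq_sSup_image]
  refine Real.sSup_nonneg ?_
  rintro _ ⟨u, _, rfl⟩
  exact norm_nonneg _

lemma norm_tensorForm_le_injNorm (T : (Fin p → Fin d) → ℂ)
    {u : Fin p → EuclideanSpace ℂ (Fin d)} (hu : ∀ m, ‖u m‖ = 1) :
    ‖tensorForm T fun m => (u m).ofLp‖ ≤ injNorm T := by
  rw [injNorm_eq_sSup_image]
  exact le_csSup (isCompact_unitVectors.bddAbove_image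
    (continuous_norm_tensorForm.comp (Continuous.prodMk_right T)).continuousOn) ⟨u, hu, rfl⟩

lemma exists_injNorm_eq (hd : 1 ≤ d) (T : (Fin p → Fin d) → ℂ) :
    ∃ u : Fin p → EuclideanSpace ℂ (Fin d), (∀ m, ‖u m‖ = 1) ∧
      injNorm T = ‖tensorForm T fun m => (u m).ofLp‖ := by
  have hne : {u : Fin p → EuclideanSpace ℂ (Fin d) | ∀ m, ‖u m‖ = 1}.Nonempty :=
    ⟨fun _ => EuclideanSpace.single ⟨0, hd⟩ 1, fun _ => by simp⟩
  obtain ⟨u, hu, h⟩ := isCompact_unitVectors.exists_sSup_image_eq hne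
    (continuous_norm_tensorForm.comp (Continuous.prodMk_right T)).continuousOn
  exact ⟨u, hu, (injNorm_eq_sSup_image T).trans h⟩

lemma factorial_mul_injNorm_pow_le_lintegral (hd : 1 ≤ d) (T : (Fin p → Fin d) → ℂ) (k : ℕ) :
    ENNReal.ofReal ((k.factorial : ℝ) ^ p * injNorm T ^ (2 * k)) ≤
      ∫⁻ g, ENNReal.ofReal (‖tensorForm T g‖ ^ (2 * k))
        ∂(Measure.pi fun _ => Measure.pi fun _ => complexGaussian) := by
  obtain ⟨u, hu, h⟩ := exists_injNorm_eq hd T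
  rw [h]
  refine factorial_pow_mul_norm_pow_le_lintegral k (tensorForm T)
    (continuous_tensorForm.comp (Continuous.prodMk_right T)) fun m => ?_
  have := EuclideanSpace.norm_sq_eq (u m)
  rw [hu m, one_pow] at this
  exact this.symm

end InjNorm

section Law

/-- The tensor `∑ i, y_1^{(i)} ⊗ ⋯ ⊗ y_p^{(i)}` in coordinates. -/
def sumTensor {R p d : ℕ} (y : Fin R → Fin p → Fin d → ℂ) : (Fin p → Fin d) → ℂ :=
  fun j => ∑ i, ∏ m, y i m (j m)

lemma continuous_sumTensor {R p d : ℕ} :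
    Continuous (sumTensor : (Fin R → Fin p → Fin d → ℂ) → _) := by
  unfold sumTensor
  fun_prop

lemma tensorForm_sumTensor {R p d : ℕ} (y : Fin R → Fin p → Fin d → ℂ) (u : Fin p → Fin d → ℂ) :
    tensorForm (sumTensor y) u = ∑ i, ∏ m, ∑ j, u m j * (starRingEnd ℂ) (y i m j) := by
  simp_rw [tensorForm_apply, sumTensor, map_sum, map_prod, Finset.sum_mul,
    ← Finset.prod_mul_distrib, Fintype.prod_sum]
  rw [Finset.sum_comm]
  simp_rw [mul_comm]

/-- The properties of the law of a rigidly sub-Gaussian variable of variance `1 / d`. -/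
structure IsRigidLaw (d : ℕ) (ν : Measure ℂ) : Prop where
  isProbabilityMeasure : IsProbabilityMeasure ν
  circular : HasCircularMoments ν (fun z => z)
  moment_le : ∀ k : ℕ, ∫ z, ‖z‖ ^ (2 * k) ∂ν ≤ k.factorial * (1 / (d : ℝ)) ^ k
  variance : ∫ z, ‖z‖ ^ 2 ∂ν = 1 / (d : ℝ)
  map_neg : ν.map (fun z => -z) = ν

lemma IsRigidlySubGaussian.isRigidLaw {Ω : Type*} [MeasurableSpace Ω] {P : Measure Ω}
    [IsProbabilityMeasure P] {Y : Ω → ℂ} (h : IsRigidlySubGaussian P Y) {d : ℕ}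
    (hvar : ∫ ω, ‖Y ω‖ ^ 2 ∂P = 1 / (d : ℝ)) : IsRigidLaw d (P.map Y) where
  isProbabilityMeasure := Measure.isProbabilityMeasure_map h.measurable.aemeasurable
  circular := by
    refine hasCircularMoments_of_map_eq measurable_id (fun k => ?_) fun θ => ?_
    · rw [integrable_map_measure (by fun_prop) h.measurable.aemeasurable]
      exact h.integrable k
    · rw [Measure.map_map (by fun_prop) h.measurable]
      exact (h.circular θ).trans Measure.map_id.symm
  moment_le k := by
    rw [integral_map h.measurable.aemeasurable (by fun_prop), ← hvar]
    exact h.moment_le k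
  variance := by
    rw [integral_map h.measurable.aemeasurable (by fun_prop), ← hvar]
  map_neg := by
    rw [Measure.map_map (by fun_prop) h.measurable]
    have := h.circular Real.pi
    simp only [Complex.exp_pi_mul_I, neg_mul, one_mul] at this
    exact this

variable {R p d : ℕ}

/-- The joint law of the coordinates of the model. -/
noncomputable abbrev modelLaw (ν : Fin R → Fin p → Fin d → Measure ℂ) :
    Measure (Fin R → Fin p → Fin d → ℂ) :=
  Measure.pi fun i => Measure.pi fun m => Measure.pi fun j => ν i m j

lemma IsBoundedRankModel.map_eq {Ω : Type*} [MeasurableSpace Ω] {P : Measure Ω}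
    [IsProbabilityMeasure P] {x : Fin R → Fin p → Fin d → Ω → ℂ} (h : IsBoundedRankModel P x) :
    P.map (fun ω i m j => x i m j ω) = modelLaw fun i m j => P.map (x i m j) := by
  have hx : ∀ i m j, Measurable (x i m j) := fun i m j => (h.rigid i m j).measurable
  have : ∀ i m j, IsProbabilityMeasure (P.map (x i m j)) := fun i m j =>
    Measure.isProbabilityMeasure_map (hx i m j).aemeasurable
  have hjoint := (iIndepFun_iff_map_fun_eq_infinitePi_map
    (fun q : Fin R × Fin p × Fin d => hx q.1 q.2.1 q.2.2)).1 h.indep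
  have houter := Measure.infinitePi_map_curry
    (fun (i : Fin R) (q : Fin p × Fin d) => P.map (x i q.1 q.2))
  have hinner := fun i : Fin R => Measure.infinitePi_map_curry
    (fun (m : Fin p) (j : Fin d) => P.map (x i m j))
  simp_rw [Measure.infinitePi_eq_pi] at hjoint houter hinner
  have hmp := measurePreserving_pi
    (fun i : Fin R => Measure.pi fun q : Fin p × Fin d => P.map (x i q.1 q.2))
    (fun i : Fin R => Measure.pi fun m => Measure.pi fun j => P.map (x i m j))
    (f := fun _ => MeasurableEquiv.curry (Fin p) (Fin d) ℂ)
    (fun i => ⟨MeasurableEquiv.measurable _, hinner i⟩)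
  rw [modelLaw, ← hmp.map_eq, ← houter, ← hjoint, Measure.map_map, Measure.map_map]
  · rfl
  all_goals fun_prop

end Law

section UpperBound

variable {R p d : ℕ}

lemma multinomial_sq_mul_prod_factorial_pow (p : ℕ) {k : ℕ} {a : Fin R → ℕ}
    (ha : a ∈ Finset.piAntidiag (Finset.univ : Finset (Fin R)) k) :
    (Nat.multinomial Finset.univ a : ℝ) ^ 2 * ∏ s, ((a s).factorial : ℝ) ^ p =
      (k.factorial : ℝ) ^ 2 * ∏ s, ((a s).factorial : ℝ) ^ ((p : ℤ) - 2) := by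
  have h : ∀ s, ((a s).factorial : ℝ) ^ p =
      ((a s).factorial : ℝ) ^ 2 * ((a s).factorial : ℝ) ^ ((p : ℤ) - 2) := fun s => by
    rw [← zpow_natCast, ← zpow_natCast, ← zpow_add₀ (by positivity)]
    norm_num
  simp_rw [h]
  rw [Finset.prod_mul_distrib, Finset.prod_pow, ← multinomial_mul_prod_factorial a ha]
  ring

lemma integral_norm_tensorForm_pow_le (hp : 1 ≤ p) {ν : Fin R → Fin p → Fin d → Measure ℂ}
    (hν : ∀ i m j, IsRigidLaw d (ν i m j)) (g : Fin p → Fin d → ℂ) (k : ℕ) :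
    Integrable (fun y => ‖tensorForm (sumTensor y) g‖ ^ (2 * k)) (modelLaw ν) ∧
    ∫ y, ‖tensorForm (sumTensor y) g‖ ^ (2 * k) ∂(modelLaw ν) ≤
      (k.factorial : ℝ) ^ 2 * (∑ a ∈ Finset.piAntidiag (Finset.univ : Finset (Fin R)) k,
        ∏ s, ((a s).factorial : ℝ) ^ ((p : ℤ) - 2)) * (∏ m, (∑ j, ‖g m j‖ ^ 2) / d) ^ k := by
  have : ∀ i m j, IsProbabilityMeasure (ν i m j) := fun i m j => (hν i m j).isProbabilityMeasure
  have : Nonempty (Fin p) := ⟨⟨0, hp⟩⟩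
  have hentry : ∀ i m j, HasCircularMoments (ν i m j) (fun z => g m j * (starRingEnd ℂ) z) :=
    fun i m j => (hν i m j).circular.conj.const_mul _
  have hvec := fun i m => HasCircularMoments.sum (hentry i m)
  have hrank := fun i => HasCircularMoments.prod (hvec i)
  have hsum := HasCircularMoments.sum hrank
  have hvec_le : ∀ i m (b : ℕ), ∫ x, ‖∑ j, g m j * (starRingEnd ℂ) (x j)‖ ^ (2 * b)
      ∂(Measure.pi fun j => ν i m j) ≤ b.factorial * ((∑ j, ‖g m j‖ ^ 2) / d) ^ b := by
    intro i m b
    rw [Finset.sum_div]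
    refine HasCircularMoments.integral_norm_sum_pow_le (hentry i m) (fun j b => ?_) b
    simp_rw [norm_mul, mul_pow, RCLike.norm_conj]
    rw [integral_const_mul, div_eq_mul_one_div, mul_pow, mul_left_comm, ← pow_mul]
    exact mul_le_mul_of_nonneg_left ((hν i m j).moment_le b) (by positivity)
  simp_rw [tensorForm_sumTensor]
  refine ⟨hsum.integrable_norm_pow k, ?_⟩
  rw [HasCircularMoments.integral_norm_sum_pow hrank, Finset.mul_sum, Finset.sum_mul]
  refine Finset.sum_le_sum fun a ha => ?_
  rw [← multinomial_sq_mul_prod_factorial_pow p ha, mul_assoc]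
  gcongr
  have hk : (∏ m, (∑ j, ‖g m j‖ ^ 2) / (d : ℝ)) ^ k =
      ∏ s, (∏ m, (∑ j, ‖g m j‖ ^ 2) / (d : ℝ)) ^ a s := by
    rw [Finset.prod_pow_eq_pow_sum, (Finset.mem_piAntidiag.1 ha).1]
  rw [hk, ← Finset.prod_mul_distrib]
  refine Finset.prod_le_prod (fun s _ => by positivity) fun s _ => ?_
  rw [integral_norm_prod_pow (f := fun (m : Fin p) (x : Fin d → ℂ) => ∑ j, g m j * (starRingEnd ℂ) (x j))]
  calc _ ≤ ∏ m, ((a s).factorial * ((∑ j, ‖g m j‖ ^ 2) / (d : ℝ)) ^ a s) :=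
        Finset.prod_le_prod (fun m _ => by positivity) fun m _ => hvec_le s m (a s)
    _ = _ := by
        rw [Finset.prod_mul_distrib, Finset.prod_pow]
        simp

/-- The bound for the moment of order `2 k` of the injective norm. -/
noncomputable def momentBound (R p d k : ℕ) : ℝ :=
  ((d + k - 1).choose k : ℝ) ^ p * (k.factorial : ℝ) ^ 2 *
    ∑ a ∈ Finset.piAntidiag (Finset.univ : Finset (Fin R)) k,
      ∏ s, ((a s).factorial : ℝ) ^ ((p : ℤ) - 2)

lemma momentBound_nonneg (R p d k : ℕ) : 0 ≤ momentBound R p d k := by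
  unfold momentBound
  positivity

lemma integral_prod_sum_norm_sq_pow (p d k : ℕ) :
    Integrable (fun g : Fin p → Fin d → ℂ => ∏ m, (∑ j, ‖g m j‖ ^ 2) ^ k)
      (Measure.pi fun _ => Measure.pi fun _ => complexGaussian) ∧
    ∫ g : Fin p → Fin d → ℂ, ∏ m, (∑ j, ‖g m j‖ ^ 2) ^ k
      ∂(Measure.pi fun _ => Measure.pi fun _ => complexGaussian) =
      ((k.factorial : ℝ) * (d + k - 1).choose k) ^ p := by
  refine ⟨Integrable.fintype_prod (f := fun _ (v : Fin d → ℂ) => (∑ j, ‖v j‖ ^ 2) ^ k)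
    fun _ => (HasCircularMoments.integral_sum_norm_sq_pow
      (fun _ => hasCircularMoments_complexGaussian) k).1, ?_⟩
  rw [integral_fintype_prod_eq_pow (fun v : Fin d → ℂ => (∑ j, ‖v j‖ ^ 2) ^ k),
    integral_sum_norm_sq_pow_complexGaussian]
  simp

lemma lintegral_injNorm_pow_le (hp : 1 ≤ p) (hd : 1 ≤ d)
    {ν : Fin R → Fin p → Fin d → Measure ℂ} (hν : ∀ i m j, IsRigidLaw d (ν i m j)) (k : ℕ) :
    ∫⁻ y, ENNReal.ofReal (injNorm (sumTensor y) ^ (2 * k)) ∂(modelLaw ν) ≤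
      ENNReal.ofReal (momentBound R p d k / (d : ℝ) ^ (p * k)) := by
  have : ∀ i m j, IsProbabilityMeasure (ν i m j) := fun i m j => (hν i m j).isProbabilityMeasure
  set Γ : Measure (Fin p → Fin d → ℂ) := Measure.pi fun _ => Measure.pi fun _ => complexGaussian
  set D : ℝ := (k.factorial : ℝ) ^ 2 *
    ∑ a ∈ Finset.piAntidiag (Finset.univ : Finset (Fin R)) k,
      ∏ s, ((a s).factorial : ℝ) ^ ((p : ℤ) - 2) with hD
  have hD0 : 0 ≤ D := by positivity
  have hmeas : Measurable fun q : (Fin R → Fin p → Fin d → ℂ) × (Fin p → Fin d → ℂ) =>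
      ENNReal.ofReal (‖tensorForm (sumTensor q.1) q.2‖ ^ (2 * k)) :=
    ENNReal.measurable_ofReal.comp ((continuous_tensorForm.comp
      ((continuous_sumTensor.comp continuous_fst).prodMk continuous_snd)).norm.pow _).measurable
  have hgauss := integral_prod_sum_norm_sq_pow p d k
  have hfac : (0 : ℝ) < (k.factorial : ℝ) ^ p := by positivity
  have key : ENNReal.ofReal ((k.factorial : ℝ) ^ p) *
      ∫⁻ y, ENNReal.ofReal (injNorm (sumTensor y) ^ (2 * k)) ∂(modelLaw ν) ≤
      ENNReal.ofReal ((k.factorial : ℝ) ^ p) *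
        ENNReal.ofReal (momentBound R p d k / (d : ℝ) ^ (p * k)) := by
    calc _ = ∫⁻ y, ENNReal.ofReal ((k.factorial : ℝ) ^ p * injNorm (sumTensor y) ^ (2 * k))
          ∂(modelLaw ν) := by
          rw [← lintegral_const_mul' _ _ ENNReal.ofReal_ne_top]
          simp_rw [← ENNReal.ofReal_mul hfac.le]
      _ ≤ ∫⁻ y, ∫⁻ g, ENNReal.ofReal (‖tensorForm (sumTensor y) g‖ ^ (2 * k)) ∂Γ
            ∂(modelLaw ν) :=
          lintegral_mono fun y => factorial_mul_injNorm_pow_le_lintegral hd _ k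
      _ = ∫⁻ g, ∫⁻ y, ENNReal.ofReal (‖tensorForm (sumTensor y) g‖ ^ (2 * k)) ∂(modelLaw ν) ∂Γ :=
          lintegral_lintegral_swap hmeas.aemeasurable
      _ ≤ ∫⁻ g, ENNReal.ofReal (D / (d : ℝ) ^ (p * k) * ∏ m, (∑ j, ‖g m j‖ ^ 2) ^ k) ∂Γ := by
          refine lintegral_mono fun g => ?_
          have h := integral_norm_tensorForm_pow_le hp hν g k
          dsimp only
          rw [← ofReal_integral_eq_lintegral_ofReal h.1
            (Eventually.of_forall fun y => by positivity)]
          refine ENNReal.ofReal_le_ofReal (h.2.trans_eq ?_)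
          rw [← hD, Finset.prod_div_distrib, div_pow, Finset.prod_pow, Finset.prod_const,
            Finset.card_univ, Fintype.card_fin, ← pow_mul]
          ring
      _ = ENNReal.ofReal (∫ g, D / (d : ℝ) ^ (p * k) * ∏ m, (∑ j, ‖g m j‖ ^ 2) ^ k ∂Γ) :=
          (ofReal_integral_eq_lintegral_ofReal (hgauss.1.const_mul _)
            (Eventually.of_forall fun g => by positivity)).symm
      _ = _ := by
          rw [integral_const_mul, hgauss.2, ← ENNReal.ofReal_mul hfac.le, hD, momentBound]
          congr 1
          ring
  rwa [ENNReal.mul_le_mul_iff_right (ENNReal.ofReal_pos.2 hfac).ne' ENNReal.ofReal_ne_top] at key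

lemma integral_injNorm_pow_le (hp : 1 ≤ p) (hd : 1 ≤ d)
    {ν : Fin R → Fin p → Fin d → Measure ℂ} (hν : ∀ i m j, IsRigidLaw d (ν i m j)) (k : ℕ) :
    Integrable (fun y => injNorm (sumTensor y) ^ (2 * k)) (modelLaw ν) ∧
    ∫ y, injNorm (sumTensor y) ^ (2 * k) ∂(modelLaw ν) ≤
      momentBound R p d k / (d : ℝ) ^ (p * k) := by
  have h := lintegral_injNorm_pow_le hp hd hν k
  have hnonneg : ∀ y : Fin R → Fin p → Fin d → ℂ, 0 ≤ injNorm (sumTensor y) ^ (2 * k) :=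
    fun y => pow_nonneg (injNorm_nonneg _) _
  have hint : Integrable (fun y => injNorm (sumTensor y) ^ (2 * k)) (modelLaw ν) := by
    refine ⟨((continuous_injNorm.comp continuous_sumTensor).pow _).aestronglyMeasurable, ?_⟩
    rw [hasFiniteIntegral_iff_ofReal (Eventually.of_forall hnonneg)]
    exact h.trans_lt ENNReal.ofReal_lt_top
  refine ⟨hint, ?_⟩
  rw [← ofReal_integral_eq_lintegral_ofReal hint (Eventually.of_forall hnonneg)] at h
  exact (ENNReal.ofReal_le_ofReal_iff
    (div_nonneg (momentBound_nonneg _ _ _ _) (by positivity))).1 h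

lemma integrable_injNorm (hp : 1 ≤ p) (hd : 1 ≤ d)
    {ν : Fin R → Fin p → Fin d → Measure ℂ} (hν : ∀ i m j, IsRigidLaw d (ν i m j)) :
    Integrable (fun y => injNorm (sumTensor y)) (modelLaw ν) := by
  have : ∀ i m j, IsProbabilityMeasure (ν i m j) := fun i m j => (hν i m j).isProbabilityMeasure
  refine Integrable.mono' ((integrable_const (1 : ℝ)).add
    (integral_injNorm_pow_le hp hd hν 1).1)
    (continuous_injNorm.comp continuous_sumTensor).aestronglyMeasurable
    (Eventually.of_forall fun y => ?_)
  rw [Real.norm_of_nonneg (injNorm_nonneg _)]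
  simp only [Pi.add_apply, mul_one]
  nlinarith [sq_nonneg (injNorm (sumTensor y) - 1)]

lemma integral_injNorm_le_rpow (hp : 1 ≤ p) (hd : 1 ≤ d)
    {ν : Fin R → Fin p → Fin d → Measure ℂ} (hν : ∀ i m j, IsRigidLaw d (ν i m j)) {k : ℕ}
    (hk : 1 ≤ k) :
    ∫ y, injNorm (sumTensor y) ∂(modelLaw ν) ≤
      (momentBound R p d k / (d : ℝ) ^ (p * k)) ^ (1 / (2 * (k : ℝ))) := by
  have : ∀ i m j, IsProbabilityMeasure (ν i m j) := fun i m j => (hν i m j).isProbabilityMeasure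
  have hpow := integral_injNorm_pow_le hp hd hν k
  have hI : 0 ≤ ∫ y, injNorm (sumTensor y) ∂(modelLaw ν) :=
    integral_nonneg fun y => injNorm_nonneg _
  have hjensen : (∫ y, injNorm (sumTensor y) ∂(modelLaw ν)) ^ (2 * k) ≤
      ∫ y, injNorm (sumTensor y) ^ (2 * k) ∂(modelLaw ν) :=
    (convexOn_pow (2 * k)).map_integral_le (continuous_pow _).continuousOn isClosed_Ici
      (Eventually.of_forall fun y => injNorm_nonneg _) (integrable_injNorm hp hd hν) hpow.1
  calc ∫ y, injNorm (sumTensor y) ∂(modelLaw ν)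
      = ((∫ y, injNorm (sumTensor y) ∂(modelLaw ν)) ^ (2 * k)) ^ (1 / (2 * (k : ℝ))) := by
        rw [← Real.rpow_natCast, ← Real.rpow_mul hI]
        push_cast
        rw [mul_one_div_cancel (by positivity), Real.rpow_one]
    _ ≤ _ := by
        gcongr
        exact hjensen.trans hpow.2

lemma rpow_momentBound_div (R p d : ℕ) {k : ℕ} (hk : 1 ≤ k) :
    (momentBound R p d k / (d : ℝ) ^ (p * k)) ^ (1 / (2 * (k : ℝ))) =
      1 / (d : ℝ) ^ ((p : ℝ) / 2) * momentBound R p d k ^ (1 / (2 * (k : ℝ))) := by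
  have hk0 : (k : ℝ) ≠ 0 := by positivity
  have hd0 : (0 : ℝ) ≤ d := by positivity
  rw [Real.div_rpow (momentBound_nonneg _ _ _ _) (by positivity), ← Real.rpow_natCast,
    ← Real.rpow_mul hd0, div_eq_mul_one_div, mul_comm]
  congr 3
  push_cast
  field_simp

end UpperBound

section LowerBound

variable {R p d : ℕ}

lemma integral_norm_sq_eq_one (hd : 1 ≤ d) {ν : Fin d → Measure ℂ}
    (hν : ∀ j, IsRigidLaw d (ν j)) :
    ∫ v, ∑ j, ‖v j‖ ^ 2 ∂(Measure.pi ν) = 1 := by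
  have : ∀ j, IsProbabilityMeasure (ν j) := fun j => (hν j).isProbabilityMeasure
  have hint : ∀ j, Integrable (fun z : ℂ => ‖z‖ ^ 2) (ν j) := fun j => by
    simpa using (hν j).circular.integrable_norm_pow 1
  have hint' : ∀ j, Integrable (fun v : Fin d → ℂ => ‖v j‖ ^ 2) (Measure.pi ν) := fun j =>
    integrable_comp_eval (μ := ν) (i := j) (f := fun z : ℂ => ‖z‖ ^ 2) (hint j)
  rw [integral_finsetSum _ fun j _ => hint' j]
  have heval : ∀ j, ∫ v : Fin d → ℂ, ‖v j‖ ^ 2 ∂(Measure.pi ν) = 1 / (d : ℝ) := fun j => by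
    rw [integral_comp_eval (μ := ν) (i := j) (f := fun z : ℂ => ‖z‖ ^ 2) (hint j).aestronglyMeasurable,
      (hν j).variance]
  simp_rw [heval]
  have : (d : ℝ) ≠ 0 := by positivity
  simp [this]

lemma integral_norm_fourth_le (hd : 1 ≤ d) {ν : Fin d → Measure ℂ}
    (hν : ∀ j, IsRigidLaw d (ν j)) :
    ∫ v, (∑ j, ‖v j‖ ^ 2) ^ 2 ∂(Measure.pi ν) ≤ 1 + 1 / (d : ℝ) := by
  have : ∀ j, IsProbabilityMeasure (ν j) := fun j => (hν j).isProbabilityMeasure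
  rw [(HasCircularMoments.integral_sum_norm_sq_pow (fun j => (hν j).circular) 2).2]
  calc _ ≤ ∑ r ∈ Finset.piAntidiag (Finset.univ : Finset (Fin d)) 2,
        (Nat.multinomial Finset.univ r : ℝ) *
          ∏ i, ((r i).factorial * (1 / (d : ℝ)) ^ r i) := by
        gcongr with r _ i _
        exact (hν i).moment_le (r i)
    _ = _ := by
        have hd0 : (d : ℝ) ≠ 0 := by positivity
        rw [sum_multinomial_mul_factorial, Fintype.card_fin,
          show d + 2 - 1 = d + 1 from rfl, Nat.cast_choose_two]
        push_cast
        simp only [Nat.factorial]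
        field_simp
        ring

lemma integral_norm_vector_ge (hd : 1 ≤ d) {ν : Fin d → Measure ℂ}
    (hν : ∀ j, IsRigidLaw d (ν j)) :
    Integrable (fun v : Fin d → ℂ => ‖WithLp.toLp 2 v‖) (Measure.pi ν) ∧
    1 - 1 / (2 * (d : ℝ)) ≤ ∫ v : Fin d → ℂ, ‖WithLp.toLp 2 v‖ ∂(Measure.pi ν) := by
  have : ∀ j, IsProbabilityMeasure (ν j) := fun j => (hν j).isProbabilityMeasure
  have hsq : ∀ v : Fin d → ℂ, ∑ j, ‖v j‖ ^ 2 = ‖WithLp.toLp 2 v‖ ^ 2 := fun v => by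
    rw [EuclideanSpace.norm_sq_eq]
  have hcirc : ∀ j, HasCircularMoments (ν j) (fun z => z) := fun j => (hν j).circular
  have h1 := (HasCircularMoments.integral_sum_norm_sq_pow hcirc 1).1
  have h2 := (HasCircularMoments.integral_sum_norm_sq_pow hcirc 2).1
  have e1 := integral_norm_sq_eq_one hd hν
  have e2 := integral_norm_fourth_le hd hν
  simp_rw [hsq] at h1 h2 e1 e2
  simp only [pow_one] at h1
  have hint : Integrable (fun v : Fin d → ℂ => ‖WithLp.toLp 2 v‖) (Measure.pi ν) := by
    refine Integrable.mono' ((integrable_const (1 : ℝ)).add h1)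
      (Continuous.aestronglyMeasurable (by fun_prop)) (Eventually.of_forall fun v => ?_)
    rw [norm_norm, Pi.add_apply]
    nlinarith [sq_nonneg (‖WithLp.toLp 2 v‖ - 1)]
  refine ⟨hint, ?_⟩
  calc 1 - 1 / (2 * (d : ℝ)) ≤ 3 / 2 * 1 - 1 / 2 * (1 + 1 / (d : ℝ)) := by
        apply le_of_eq
        ring
    _ ≤ 3 / 2 * ∫ v : Fin d → ℂ, ‖WithLp.toLp 2 v‖ ^ 2 ∂(Measure.pi ν) -
          1 / 2 * ∫ v : Fin d → ℂ, (‖WithLp.toLp 2 v‖ ^ 2) ^ 2 ∂(Measure.pi ν) := by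
        rw [e1]
        linarith
    _ = ∫ v : Fin d → ℂ, (3 / 2 * ‖WithLp.toLp 2 v‖ ^ 2 - 1 / 2 * (‖WithLp.toLp 2 v‖ ^ 2) ^ 2)
          ∂(Measure.pi ν) := by
        rw [integral_sub (h1.const_mul _) (h2.const_mul _), integral_const_mul,
          integral_const_mul]
    _ ≤ _ := by
        refine integral_mono ((h1.const_mul _).sub (h2.const_mul _)) hint fun v => ?_
        have ht := norm_nonneg (WithLp.toLp 2 v)
        have : 0 ≤ ‖WithLp.toLp 2 v‖ * ((‖WithLp.toLp 2 v‖ - 1) ^ 2 *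
          (‖WithLp.toLp 2 v‖ + 2)) := by positivity
        dsimp only
        nlinarith

/-- The signs that flip one factor of every rank-one summand but the `i₀`-th. -/
def flipSign (i₀ : Fin R) (m₀ : Fin p) (i : Fin R) (m : Fin p) : ℂ :=
  if i ≠ i₀ ∧ m = m₀ then -1 else 1

lemma measurePreserving_flip {ν : Fin R → Fin p → Fin d → Measure ℂ}
    (hν : ∀ i m j, IsRigidLaw d (ν i m j)) (i₀ : Fin R) (m₀ : Fin p) :
    MeasurePreserving (fun (y : Fin R → Fin p → Fin d → ℂ) i m j => flipSign i₀ m₀ i m * y i m j)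
      (modelLaw ν) (modelLaw ν) := by
  have : ∀ i m j, IsProbabilityMeasure (ν i m j) := fun i m j => (hν i m j).isProbabilityMeasure
  have hentry : ∀ i m j, MeasurePreserving (fun z : ℂ => flipSign i₀ m₀ i m * z)
      (ν i m j) (ν i m j) := fun i m j => by
    unfold flipSign
    split_ifs
    · simpa only [neg_mul, one_mul] using ⟨measurable_neg, (hν i m j).map_neg⟩
    · simp only [one_mul]
      exact MeasurePreserving.id _
  exact measurePreserving_pi _ _ fun i => measurePreserving_pi _ _ fun m =>
    measurePreserving_pi _ _ fun j => hentry i m j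

lemma two_mul_prod_norm_le (y : Fin R → Fin p → Fin d → ℂ) (i₀ : Fin R) (m₀ : Fin p) :
    2 * ∏ m, ‖WithLp.toLp 2 (y i₀ m)‖ ≤ injNorm (sumTensor y) +
      injNorm (sumTensor fun i m j => flipSign i₀ m₀ i m * y i m j) := by
  by_cases h0 : ∃ m, WithLp.toLp 2 (y i₀ m) = 0
  · obtain ⟨m, hm⟩ := h0
    rw [Finset.prod_eq_zero (Finset.mem_univ m) (by rw [hm, norm_zero]), mul_zero]
    exact add_nonneg (injNorm_nonneg _) (injNorm_nonneg _)
  push Not at h0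
  set u : Fin p → EuclideanSpace ℂ (Fin d) := fun m =>
    ((‖WithLp.toLp 2 (y i₀ m)‖⁻¹ : ℝ) : ℂ) • WithLp.toLp 2 (y i₀ m) with hu
  have hnorm : ∀ m, ‖u m‖ = 1 := fun m => by
    rw [hu, norm_smul, Complex.norm_real, norm_inv, norm_norm,
      inv_mul_cancel₀ (norm_ne_zero_iff.2 (h0 m))]
  set A : Fin R → Fin p → ℂ := fun i m => ∑ j, (u m).ofLp j * (starRingEnd ℂ) (y i m j) with hA
  have hdiag : ∀ m, A i₀ m = (‖WithLp.toLp 2 (y i₀ m)‖ : ℝ) := fun m => by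
    have h2 : ∑ j, ‖y i₀ m j‖ ^ 2 = ‖WithLp.toLp 2 (y i₀ m)‖ ^ 2 := by
      rw [EuclideanSpace.norm_sq_eq]
    have hne := norm_ne_zero_iff.2 (h0 m)
    simp only [hA, hu, PiLp.smul_apply, smul_eq_mul, mul_assoc, Complex.mul_conj,
      Complex.normSq_eq_norm_sq]
    rw [← Finset.mul_sum, ← Complex.ofReal_sum, h2, ← Complex.ofReal_mul]
    congr 1
    field_simp
  have hflip : ∀ i, ∏ m, ∑ j, (u m).ofLp j *
      (starRingEnd ℂ) (flipSign i₀ m₀ i m * y i m j) = (if i = i₀ then 1 else -1) * ∏ m, A i m := by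
    intro i
    have hreal : ∀ m, (starRingEnd ℂ) (flipSign i₀ m₀ i m) = flipSign i₀ m₀ i m := fun m => by
      unfold flipSign
      split_ifs <;> simp
    have hprod : ∏ m, flipSign i₀ m₀ i m = if i = i₀ then 1 else -1 := by
      unfold flipSign
      split_ifs with hi <;> simp [hi]
    rw [← hprod, ← Finset.prod_mul_distrib]
    refine Finset.prod_congr rfl fun m _ => ?_
    rw [hA, Finset.mul_sum]
    refine Finset.sum_congr rfl fun j _ => ?_
    rw [map_mul, hreal]
    ring
  have h1 := norm_tensorForm_le_injNorm (sumTensor y) hnorm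
  have h2 := norm_tensorForm_le_injNorm
    (sumTensor fun i m j => flipSign i₀ m₀ i m * y i m j) hnorm
  rw [tensorForm_sumTensor] at h1 h2
  simp_rw [hflip] at h2
  have hsum : ∑ i, ∏ m, A i m + ∑ i, (if i = i₀ then 1 else -1) * ∏ m, A i m =
      2 * ∏ m, A i₀ m := by
    rw [← Finset.sum_add_distrib, Finset.sum_eq_single i₀]
    · rw [if_pos rfl]
      ring
    · intro i _ hi
      rw [if_neg hi]
      ring
    · simp
  calc 2 * ∏ m, ‖WithLp.toLp 2 (y i₀ m)‖ = ‖2 * ∏ m, A i₀ m‖ := by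
        simp_rw [hdiag]
        simp
    _ ≤ _ := by
        rw [← hsum]
        exact (norm_add_le _ _).trans (add_le_add h1 h2)

lemma le_integral_injNorm (hp : 1 ≤ p) (hR : 1 ≤ R) (hd : 1 ≤ d)
    {ν : Fin R → Fin p → Fin d → Measure ℂ} (hν : ∀ i m j, IsRigidLaw d (ν i m j)) :
    (1 - 1 / (2 * (d : ℝ))) ^ p ≤ ∫ y, injNorm (sumTensor y) ∂(modelLaw ν) := by
  have : ∀ i m j, IsProbabilityMeasure (ν i m j) := fun i m j => (hν i m j).isProbabilityMeasure
  let i₀ : Fin R := ⟨0, hR⟩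
  let m₀ : Fin p := ⟨0, hp⟩
  have hvec := fun m => integral_norm_vector_ge hd (hν i₀ m)
  have hd' : (1 : ℝ) ≤ d := by exact_mod_cast hd
  have hbase : 0 ≤ 1 - 1 / (2 * (d : ℝ)) := by
    rw [sub_nonneg, div_le_one (by positivity)]
    linarith
  have hmp := measurePreserving_flip hν i₀ m₀
  have hinj := integrable_injNorm hp hd hν
  have hprod : Integrable (fun x : Fin p → Fin d → ℂ => ∏ m, ‖WithLp.toLp 2 (x m)‖)
      (Measure.pi fun m => Measure.pi fun j => ν i₀ m j) :=
    Integrable.fintype_prod (f := fun _ v => ‖WithLp.toLp 2 v‖) fun m => (hvec m).1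
  have hflip_int : Integrable (fun y : Fin R → Fin p → Fin d → ℂ =>
      injNorm (sumTensor fun i m j => flipSign i₀ m₀ i m * y i m j)) (modelLaw ν) :=
    hmp.integrable_comp_of_integrable hinj
  have hflip_eq : ∫ y, injNorm (sumTensor fun i m j => flipSign i₀ m₀ i m * y i m j)
      ∂(modelLaw ν) = ∫ y, injNorm (sumTensor y) ∂(modelLaw ν) := by
    conv_rhs => rw [← hmp.map_eq]
    exact (integral_map hmp.aemeasurable
      (continuous_injNorm.comp continuous_sumTensor).aestronglyMeasurable).symm
  have hmono := integral_mono
    ((integrable_comp_eval (μ := fun i => Measure.pi fun m => Measure.pi fun j => ν i m j)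
      (i := i₀) hprod).const_mul 2)
    (hinj.add hflip_int) fun y => two_mul_prod_norm_le y i₀ m₀
  rw [integral_const_mul, integral_comp_eval
    (μ := fun i => Measure.pi fun m => Measure.pi fun j => ν i m j) (i := i₀)
    (f := fun x => ∏ m, ‖WithLp.toLp 2 (x m)‖) hprod.aestronglyMeasurable,
    integral_fintype_prod_eq_prod (fun _ (v : Fin d → ℂ) => ‖WithLp.toLp 2 v‖)] at hmono
  rw [integral_add' hinj hflip_int, hflip_eq, ← two_mul] at hmono
  calc (1 - 1 / (2 * (d : ℝ))) ^ p = ∏ _m : Fin p, (1 - 1 / (2 * (d : ℝ))) := by simp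
    _ ≤ ∏ m, ∫ v : Fin d → ℂ, ‖WithLp.toLp 2 v‖ ∂(Measure.pi fun j => ν i₀ m j) :=
        Finset.prod_le_prod (fun _ _ => hbase) fun m _ => (hvec m).2
    _ ≤ _ := by linarith

end LowerBound

lemma card_piAntidiag_fin_le (R k : ℕ) :
    (Finset.piAntidiag (Finset.univ : Finset (Fin R)) k).card ≤ (k + 1) ^ R := by
  have hsub : Finset.piAntidiag (Finset.univ : Finset (Fin R)) k ⊆
      Fintype.piFinset fun _ => Finset.range (k + 1) := by
    intro a ha
    rw [Finset.mem_piAntidiag] at ha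
    rw [Fintype.mem_piFinset]
    intro s
    rw [Finset.mem_range, Nat.lt_succ_iff, ← ha.1]
    exact Finset.single_le_sum (fun _ _ => Nat.zero_le _) (Finset.mem_univ s)
  simpa using Finset.card_le_card hsub

lemma momentBound_div_le {R p d k : ℕ} (hp : 2 ≤ p) (hd : 1 ≤ d) :
    momentBound R p d k / (d : ℝ) ^ (p * k) ≤
      ((1 + (k : ℝ) / d) ^ k) ^ p * ((k : ℝ) + 1) ^ R := by
  have hd0 : (0 : ℝ) < d := by positivity
  have hterm : ∀ a ∈ Finset.piAntidiag (Finset.univ : Finset (Fin R)) k,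
      ∏ s, ((a s).factorial : ℝ) ^ ((p : ℤ) - 2) ≤ (k.factorial : ℝ) ^ (p - 2) := by
    intro a ha
    have hcast : (p : ℤ) - 2 = ((p - 2 : ℕ) : ℤ) := by omega
    simp_rw [hcast, zpow_natCast]
    rw [Finset.prod_pow]
    gcongr
    have h := Nat.prod_factorial_dvd_factorial_sum Finset.univ a
    rw [(Finset.mem_piAntidiag.1 ha).1] at h
    exact_mod_cast Nat.le_of_dvd (Nat.factorial_pos k) h
  have hsum : ∑ a ∈ Finset.piAntidiag (Finset.univ : Finset (Fin R)) k,
      ∏ s, ((a s).factorial : ℝ) ^ ((p : ℤ) - 2) ≤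
      ((k : ℝ) + 1) ^ R * (k.factorial : ℝ) ^ (p - 2) := by
    refine (Finset.sum_le_card_nsmul _ _ _ hterm).trans ?_
    rw [nsmul_eq_mul]
    gcongr
    exact_mod_cast card_piAntidiag_fin_le R k
  have hchoose : ((d + k - 1).choose k : ℝ) * k.factorial ≤ ((d : ℝ) + k) ^ k := by
    have h := Nat.descFactorial_le_pow (d + k - 1) k
    rw [Nat.descFactorial_eq_factorial_mul_choose, mul_comm] at h
    have h2 : (d + k - 1) ^ k ≤ (d + k) ^ k := Nat.pow_le_pow_left (Nat.sub_le _ _) k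
    exact_mod_cast h.trans h2
  rw [div_le_iff₀ (by positivity)]
  calc momentBound R p d k ≤ ((d + k - 1).choose k : ℝ) ^ p * (k.factorial : ℝ) ^ 2 *
        (((k : ℝ) + 1) ^ R * (k.factorial : ℝ) ^ (p - 2)) := by
        unfold momentBound
        gcongr
    _ = (((d + k - 1).choose k : ℝ) * k.factorial) ^ p * ((k : ℝ) + 1) ^ R := by
        obtain ⟨q, rfl⟩ := Nat.exists_eq_add_of_le hp
        rw [Nat.add_sub_cancel_left]
        ring
    _ ≤ (((d : ℝ) + k) ^ k) ^ p * ((k : ℝ) + 1) ^ R := by gcongr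
    _ = _ := by
        have : (d : ℝ) + k = (1 + (k : ℝ) / d) * d := by field_simp
        rw [this, mul_pow, mul_pow, ← pow_mul (d : ℝ), mul_comm k p]
        ring

/-- A sequence squeezed between the lower bound and all the moment bounds tends to `1`. -/
lemma tendsto_one_of_momentBound {R p : ℕ} (hp : 2 ≤ p) {E : ℕ → ℝ}
    (hlow : ∀ d : ℕ, 1 ≤ d → (1 - 1 / (2 * (d : ℝ))) ^ p ≤ E d)
    (hupp : ∀ d k : ℕ, 1 ≤ d → 1 ≤ k →
      E d ≤ (momentBound R p d k / (d : ℝ) ^ (p * k)) ^ (1 / (2 * (k : ℝ)))) :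
    Tendsto E atTop (𝓝 1) := by
  refine tendsto_order.2 ⟨fun a ha => ?_, fun a ha => ?_⟩
  · have hlim : Tendsto (fun d : ℕ => (1 - 1 / (2 * (d : ℝ))) ^ p) atTop (𝓝 ((1 - 0) ^ p)) := by
      refine (tendsto_const_nhds.sub ?_).pow p
      exact tendsto_const_nhds.div_atTop
        (tendsto_natCast_atTop_atTop.const_mul_atTop two_pos)
    rw [sub_zero, one_pow] at hlim
    filter_upwards [hlim.eventually (lt_mem_nhds ha), eventually_ge_atTop 1] with d h1 hd
    exact h1.trans_le (hlow d hd)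
  · have hk : Tendsto (fun k : ℕ => (((k : ℝ) + 1) ^ R) ^ (1 / (2 * (k : ℝ)))) atTop (𝓝 1) := by
      have h := (tendsto_rpow_div_mul_add (R : ℝ) 2 (-2) (by norm_num)).comp
        (tendsto_natCast_atTop_atTop.atTop_add (tendsto_const_nhds (x := (1 : ℝ))))
      refine h.congr fun k => ?_
      simp only [Function.comp_apply]
      rw [← Real.rpow_natCast, ← Real.rpow_mul (by positivity)]
      congr 1
      ring
    obtain ⟨k, hka, hk1⟩ := ((hk.eventually (gt_mem_nhds ha)).and (eventually_ge_atTop 1)).exists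
    have hd : Tendsto (fun d : ℕ => (((1 + (k : ℝ) / d) ^ k) ^ p * ((k : ℝ) + 1) ^ R) ^
        (1 / (2 * (k : ℝ)))) atTop
        (𝓝 ((((1 + 0) ^ k) ^ p * ((k : ℝ) + 1) ^ R) ^ (1 / (2 * (k : ℝ))))) := by
      refine Tendsto.rpow_const ?_ (Or.inr (by positivity))
      exact (((tendsto_const_nhds.add
        (tendsto_const_div_atTop_nhds_zero_nat (k : ℝ))).pow k).pow p).mul_const _
    rw [add_zero, one_pow, one_pow, one_mul] at hd
    filter_upwards [hd.eventually (gt_mem_nhds hka), eventually_ge_atTop 1] with d h1 hd1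
    refine ((hupp d k hd1 hk1).trans ?_).trans_lt h1
    have := momentBound_nonneg R p d k
    exact Real.rpow_le_rpow (by positivity) (momentBound_div_le hp hd1) (by positivity)

section Transfer

variable {Ω : Type*} [MeasurableSpace Ω] {P : Measure Ω} {R p d : ℕ}
  {x : Fin R → Fin p → Fin d → Ω → ℂ}

lemma IsBoundedRankModel.measurable_coordinates (h : IsBoundedRankModel P x) :
    Measurable fun ω i m j => x i m j ω := by
  have : ∀ i m j, Measurable (x i m j) := fun i m j => (h.rigid i m j).measurable
  fun_prop

variable [IsProbabilityMeasure P]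

lemma IsBoundedRankModel.integral_injNorm (h : IsBoundedRankModel P x) :
    ∫ ω, injNorm (boundedRankTensor x ω) ∂P =
      ∫ y, injNorm (sumTensor y) ∂(modelLaw fun i m j => P.map (x i m j)) := by
  rw [← h.map_eq]
  exact (integral_map h.measurable_coordinates.aemeasurable
    (continuous_injNorm.comp continuous_sumTensor).aestronglyMeasurable).symm

lemma IsBoundedRankModel.integrable_injNorm (h : IsBoundedRankModel P x) (hp : 1 ≤ p)
    (hd : 1 ≤ d) : Integrable (fun ω => injNorm (boundedRankTensor x ω)) P := by
  have hint := _root_.integrable_injNorm hp hd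
    fun i m j => (h.rigid i m j).isRigidLaw (h.variance i m j)
  rw [← h.map_eq] at hint
  exact (integrable_map_measure
    (continuous_injNorm.comp continuous_sumTensor).aestronglyMeasurable
    h.measurable_coordinates.aemeasurable).1 hint

end Transfer

theorem theorem5p2 (p R : ℕ) (hp : 1 ≤ p) :
    (∀ d k : ℕ, 1 ≤ d → 1 ≤ k →
      ∀ (Ω : Type*) [MeasurableSpace Ω] (P : Measure Ω) [IsProbabilityMeasure P]
        (x : Fin R → Fin p → Fin d → Ω → ℂ), IsBoundedRankModel P x →
        Integrable (fun ω => injNorm (boundedRankTensor x ω)) P ∧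
        ∫ ω, injNorm (boundedRankTensor x ω) ∂P ≤
          1 / (d : ℝ) ^ ((p : ℝ) / 2) *
            (((d + k - 1).choose k : ℝ) ^ p * (k.factorial : ℝ) ^ 2 *
              ∑ a ∈ Finset.piAntidiag (Finset.univ : Finset (Fin R)) k,
                ∏ s, ((a s).factorial : ℝ) ^ ((p : ℤ) - 2)) ^ (1 / (2 * (k : ℝ)))) ∧
    (2 ≤ p → 1 ≤ R →
      ∀ (Ω : ℕ → Type*) [∀ d, MeasurableSpace (Ω d)] (P : ∀ d, Measure (Ω d))
        [∀ d, IsProbabilityMeasure (P d)]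
        (x : ∀ d, Fin R → Fin p → Fin d → Ω d → ℂ),
        (∀ d, 1 ≤ d → IsBoundedRankModel (P d) (x d)) →
        Tendsto (fun d => ∫ ω, injNorm (boundedRankTensor (x d) ω) ∂(P d)) atTop (𝓝 1)) := by
  refine ⟨fun d k hd hk Ω _ P _ x h => ⟨h.integrable_injNorm hp hd, ?_⟩,
    fun hp2 hR Ω _ P _ x h => tendsto_one_of_momentBound (R := R) hp2 (fun d hd => ?_)
      fun d k hd hk => ?_⟩
  · rw [h.integral_injNorm]
    exact (integral_injNorm_le_rpow hp hd
      (fun i m j => (h.rigid i m j).isRigidLaw (h.variance i m j)) hk).trans_eq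
      (rpow_momentBound_div R p d hk)
  · rw [(h d hd).integral_injNorm]
    exact le_integral_injNorm hp hR hd
      fun i m j => ((h d hd).rigid i m j).isRigidLaw ((h d hd).variance i m j)
  · rw [(h d hd).integral_injNorm]
    exact integral_injNorm_le_rpow hp hd
      (fun i m j => ((h d hd).rigid i m j).isRigidLaw ((h d hd).variance i m j)) hk
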